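/- Let $\Gamma$ be a finite, compact metric graph (not necessarily connected; multiple edges are allowed) with edges $e_n=[x_{2n-1},x_{2n}]$, $x_{2n-1}<x_{2n}$, $n=1,\dots,E$, whose vertices are the classes of a partition of the set of endpoints $\{x_1,\dots,x_{2E}\}$. Assume that $\Gamma$ is bipartite, with vertex set the disjoint union of $\mathcal V_1$ and $\mathcal V_2$, and that every edge is oriented from $\mathcal V_1$ to $\mathcal V_2$, i.e. each left endpoint $x_{2n-1}$ belongs to a vertex in $\mathcal V_1$ and each right endpoint $x_{2n}$ to a vertex in $\mathcal V_2$. Let $L^2(\Gamma)=\bigoplus_{n=1}^E L^2(e_n)$ (complex-valued functions), and let $W^k_2(\Gamma\setminus\mathcal V)$ be the space of $f\in L^2(\Gamma)$ whose weak derivatives up to order $k$ inside every edge exist and lie in $L^2(\Gamma)$. For an endpoint $x_j$ write $f(x_j)$ for the limit of $f$ at $x_j$ from inside the edge, and $\partial f(x_j)=f'(x_j)$ if $x_j$ is a left endpoint, $\partial f(x_j)=-f'(x_j)$ if $x_j$ is a right endpoint. Define the following operators in $L^2(\Gamma)$. - The standard Laplacian $L^{\rm st}(\Gamma)$: $f\mapsto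 -f''$ on all $f\in W_2^2(\Gamma\setminus\mathcal V)$ such that at each vertex $v$ one has $f(x_i)=f(x_j)$ for all $x_i,x_j\in v$ and $\sum_{x_j\in v}\partial f(x_j)=0$. - The anti-standard Laplacian $L^{\rm a/st}(\Gamma)$: $f\mapsto -f''$ on all $f\in W_2^2(\Gamma\setminus\mathcal V)$ such that at each vertex $v$ one has $\sum_{x_j\in v}f(x_j)=0$ and $\partial f(x_i)=\partial f(x_j)$ for all $x_i,x_j\in v$. - The momentum operator $D$: $f\mapsto \frac1i f'$ on all $f\in W_2^1(\Gamma\setminus\mathcal V)$ such that $f(x_i)=f(x_j)$ whenever $x_i,x_j$ belong to the same vertex. Then $D$ is densely defined and, with $D^*$ its Hilbert space adjoint and with products of operators taken on their natural domains, $$L^{\rm st}(\Gamma)=D^*D\qquad\text{and}\qquad L^{\rm a/st}(\Gamma)=DD^*.$$ In particular, the positive eigenvalues of $L^{\rm st}(\Gamma)$ and $L^{\rm a/st}(\Gamma)$ coincide including multiplicities: for every real $\mu>0$, $\mu$ is an eigenvalue of one operator if and only if it is an eigenvalue of the other, and $\dim\ker(L^{\rm st}(\Gamma)-\mu)=\dim\ker(L^{\rm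 a/st}(\Gamma)-\mu)$. -/

import Mathlib

open MeasureTheory Filter Topology
open scoped ContDiff InnerProductSpace

noncomputable section

namespace UnboundedOperator

variable {H : Type*} [AddCommGroup H] [Module ℂ H]

/-- The product `S T` of two unbounded operators, with its natural domain
`{x ∈ dom T | T x ∈ dom S}`. -/
def prod (S T : H →ₗ.[ℂ] H) : H →ₗ.[ℂ] H where
  domain := (S.domain.comap T.toFun).map T.domain.subtype
  toFun :=
    { toFun := fun x => S ⟨T ⟨x, Submodule.map_subtype_le _ _ x.2⟩, by
        obtain ⟨y, hy, hyx⟩ := x.2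
        have : (⟨x, Submodule.map_subtype_le _ _ x.2⟩ : T.domain) = y := Subtype.ext hyx.symm
        rw [this]; exact hy⟩
      map_add' := fun x y => by
        rw [← S.map_add]
        congr 1
        exact Subtype.ext (T.map_add ⟨x, Submodule.map_subtype_le _ _ x.2⟩
          ⟨y, Submodule.map_subtype_le _ _ y.2⟩)
      map_smul' := fun c x => by
        rw [RingHom.id_apply, ← S.map_smul]
        congr 1
        exact Subtype.ext (T.map_smul c ⟨x, Submodule.map_subtype_le _ _ x.2⟩) }

/-- The eigenspace `ker (T - μ)` of an unbounded operator. -/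
def eigenspace (T : H →ₗ.[ℂ] H) (μ : ℂ) : Submodule ℂ H :=
  (LinearMap.ker (T.toFun - μ • T.domain.subtype)).map T.domain.subtype

/-- `μ` is an eigenvalue of `T`. -/
def IsEigenvalue (T : H →ₗ.[ℂ] H) (μ : ℂ) : Prop :=
  ∃ x : T.domain, (x : H) ≠ 0 ∧ T x = μ • (x : H)

/-- The multiplicity of `μ` as an eigenvalue of `T`: the dimension of `ker (T - μ)`. -/
def multiplicity (T : H →ₗ.[ℂ] H) (μ : ℂ) : Cardinal := Module.rank ℂ (eigenspace T μ)

end UnboundedOperator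

/-- A compact metric graph: every edge `e` is a non-degenerate interval `[left e, right e]`.
The endpoint `(e, false)` is the left endpoint of `e`, the endpoint `(e, true)` the right one.
Vertices are the classes of a partition of the set of endpoints, here given by the surjection
`vertex` that sends an endpoint to its class. Loops, multiple edges and several connected
components are allowed. The graph is finite when `E` is. -/
structure MetricGraph (V E : Type*) where
  left : E → ℝ
  right : E → ℝ
  left_lt_right : ∀ e, left e < right e
  vertex : E × Bool → V
  vertex_surjective : Function.Surjective vertex

namespace MetricGraph

variable {V E : Type*} (Γ : MetricGraph V E)

/-- `V₁`, `V₂` is a bipartition of the vertex set and every edge is oriented from `V₁` to `V₂`: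
its left endpoint lies in a vertex from `V₁`, its right endpoint in a vertex from `V₂`. -/
structure IsBipartiteOriented (V₁ V₂ : Set V) : Prop where
  disjoint : Disjoint V₁ V₂
  union_eq : V₁ ∪ V₂ = Set.univ
  left_mem : ∀ e, Γ.vertex (e, false) ∈ V₁
  right_mem : ∀ e, Γ.vertex (e, true) ∈ V₂

/-- The position of an endpoint on the real line. -/
def point (j : E × Bool) : ℝ := if j.2 then Γ.right j.1 else Γ.left j.1

/-- Lebesgue measure on the edge `e`. -/
def edgeMeasure (e : E) : Measure ℝ := volume.restrict (Set.Icc (Γ.left e) (Γ.right e))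

instance (e : E) : IsFiniteMeasure (Γ.edgeMeasure e) := by
  unfold edgeMeasure; infer_instance

/-- The Hilbert space `L₂(Γ) = ⨁ₑ L₂(e)` of complex-valued functions. -/
abbrev L2 : Type _ := PiLp 2 (fun e : E => Lp ℂ 2 (Γ.edgeMeasure e))

/-- `g` is the weak derivative of `f` inside every edge. -/
def HasWeakDeriv (f g : Γ.L2) : Prop :=
  ∀ (e : E) (φ : ℝ → ℝ), ContDiff ℝ ∞ φ → HasCompactSupport φ →
    tsupport φ ⊆ Set.Ioo (Γ.left e) (Γ.right e) →
    ∫ x, deriv φ x • f e x ∂(Γ.edgeMeasure e) = - ∫ x, φ x • g e x ∂(Γ.edgeMeasure e)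

variable {Γ}

lemma integrable_smul_edge (e : E) (u : Lp ℂ 2 (Γ.edgeMeasure e)) {φ : ℝ → ℝ}
    (hφ : Continuous φ) (hc : HasCompactSupport φ) :
    Integrable (fun x => φ x • u x) (Γ.edgeMeasure e) := by
  obtain ⟨C, hC⟩ := hc.exists_bound_of_continuous hφ
  have hu : Integrable u (Γ.edgeMeasure e) := (Lp.memLp u).integrable (by norm_num)
  exact hu.bdd_smul C hφ.aestronglyMeasurable (Eventually.of_forall hC)

lemma HasWeakDeriv.add {f f' g g' : Γ.L2} (hf : Γ.HasWeakDeriv f f')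
    (hg : Γ.HasWeakDeriv g g') : Γ.HasWeakDeriv (f + g) (f' + g') := by
  intro e φ hφ hc hs
  have hd : Continuous (deriv φ) := hφ.continuous_deriv (by simp)
  have key : ∀ (u v : Lp ℂ 2 (Γ.edgeMeasure e)) (ψ : ℝ → ℝ), Continuous ψ →
      HasCompactSupport ψ → ∫ x, ψ x • (u + v) x ∂(Γ.edgeMeasure e) =
        ∫ x, ψ x • u x ∂(Γ.edgeMeasure e) + ∫ x, ψ x • v x ∂(Γ.edgeMeasure e) := by
    intro u v ψ hψ hψc
    rw [← integral_add (integrable_smul_edge e u hψ hψc) (integrable_smul_edge e v hψ hψc)]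
    apply integral_congr_ae
    filter_upwards [Lp.coeFn_add u v] with x hx
    rw [hx, Pi.add_apply, smul_add]
  rw [PiLp.add_apply, PiLp.add_apply, key _ _ _ hd hc.deriv, key _ _ _ hφ.continuous hc,
    hf e φ hφ hc hs, hg e φ hφ hc hs]
  ring

lemma HasWeakDeriv.smul {f f' : Γ.L2} (c : ℂ) (hf : Γ.HasWeakDeriv f f') :
    Γ.HasWeakDeriv (c • f) (c • f') := by
  intro e φ hφ hc hs
  have key : ∀ (u : Lp ℂ 2 (Γ.edgeMeasure e)) (ψ : ℝ → ℝ),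
      ∫ x, ψ x • (c • u) x ∂(Γ.edgeMeasure e) = c • ∫ x, ψ x • u x ∂(Γ.edgeMeasure e) := by
    intro u ψ
    rw [← integral_smul]
    apply integral_congr_ae
    filter_upwards [Lp.coeFn_smul c u] with x hx
    rw [hx, Pi.smul_apply, smul_comm]
  rw [PiLp.smul_apply, PiLp.smul_apply, key, key, hf e φ hφ hc hs, smul_neg]

lemma HasWeakDeriv.zero : Γ.HasWeakDeriv 0 0 := by
  intro e φ _ _ _
  have h0 : ∀ ψ : ℝ → ℝ,
      ∫ x, ψ x • (0 : Lp ℂ 2 (Γ.edgeMeasure e)) x ∂(Γ.edgeMeasure e) = 0 := by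
    intro ψ
    apply integral_eq_zero_of_ae
    filter_upwards [Lp.coeFn_zero ℂ 2 (Γ.edgeMeasure e)] with x hx
    rw [hx]; simp
  rw [PiLp.zero_apply, h0, h0, neg_zero]

/-- Weak derivatives are unique. -/
lemma HasWeakDeriv.unique {f g h : Γ.L2} (hg : Γ.HasWeakDeriv f g)
    (hh : Γ.HasWeakDeriv f h) : g = h := by
  ext1 e
  apply Lp.ext
  have hgi : Integrable (g e) (Γ.edgeMeasure e) := (Lp.memLp (g e)).integrable (by norm_num)
  have hhi : Integrable (h e) (Γ.edgeMeasure e) := (Lp.memLp (h e)).integrable (by norm_num)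
  have hI : LocallyIntegrableOn (fun x => g e x - h e x)
      (Set.Ioo (Γ.left e) (Γ.right e)) volume :=
    (IntegrableOn.mono_set (hgi.sub hhi) Set.Ioo_subset_Icc_self).locallyIntegrableOn
  have hz := isOpen_Ioo.ae_eq_zero_of_integral_contDiff_smul_eq_zero hI (by
    intro φ hφ hc hs
    have h1 := (hg e φ hφ hc hs).symm.trans (hh e φ hφ hc hs)
    have h2 : ∫ x, φ x • (g e x - h e x) ∂(Γ.edgeMeasure e) = 0 := by
      simp_rw [smul_sub]
      rw [integral_sub (integrable_smul_edge e _ hφ.continuous hc)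
        (integrable_smul_edge e _ hφ.continuous hc), neg_inj.mp h1, sub_self]
    rw [← h2]
    refine (setIntegral_eq_integral_of_forall_compl_eq_zero ?_).symm
    intro x hx
    have : x ∉ tsupport φ := fun hx' => hx (Set.Ioo_subset_Icc_self (hs hx'))
    rw [image_eq_zero_of_notMem_tsupport this, zero_smul])
  change ∀ᵐ x ∂(volume.restrict (Set.Icc (Γ.left e) (Γ.right e))), g e x = h e x
  rw [← Measure.restrict_congr_set Ioo_ae_eq_Icc, ae_restrict_iff' measurableSet_Ioo]
  filter_upwards [hz] with x hx hxm
  exact sub_eq_zero.mp (hx hxm)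

variable (Γ)

/-- The Sobolev space `W₂¹(Γ \ V)`. -/
def W1 : Submodule ℂ Γ.L2 where
  carrier := {f | ∃ g, Γ.HasWeakDeriv f g}
  zero_mem' := ⟨0, HasWeakDeriv.zero⟩
  add_mem' := fun ⟨_, hf⟩ ⟨_, hg⟩ => ⟨_, hf.add hg⟩
  smul_mem' := fun c _ ⟨_, hf⟩ => ⟨_, hf.smul c⟩

/-- The weak derivative `f ↦ f'` on `W₂¹(Γ \ V)`. -/
def weakDeriv : Γ.W1 →ₗ[ℂ] Γ.L2 where
  toFun f := f.2.choose
  map_add' f g := (f + g).2.choose_spec.unique (f.2.choose_spec.add g.2.choose_spec)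
  map_smul' c f := (c • f).2.choose_spec.unique (f.2.choose_spec.smul c)

lemma hasWeakDeriv_weakDeriv (f : Γ.W1) : Γ.HasWeakDeriv f (Γ.weakDeriv f) :=
  f.2.choose_spec

/-- The numbers `t j` are the limiting values of `f` at the endpoints: `f(x)` tends to `t j` as
`x` approaches the endpoint `j` inside its edge. As `f` is an almost everywhere class, null sets
are disregarded; this is the limit of the continuous representative whenever there is one. -/
def HasBoundaryValues (f : Γ.L2) (t : E × Bool → ℂ) : Prop :=
  ∀ j : E × Bool, Tendsto (f j.1) (𝓝 (Γ.point j) ⊓ ae (Γ.edgeMeasure j.1)) (𝓝 (t j))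

/-- Continuity condition at each vertex, for a family of values at the endpoints. -/
def IsContinuousAtVertices (t : E × Bool → ℂ) : Prop :=
  ∀ i j, Γ.vertex i = Γ.vertex j → t i = t j

open Classical in
/-- Balance condition at each vertex, for a family of values at the endpoints. -/
def IsBalancedAtVertices [Fintype E] (t : E × Bool → ℂ) : Prop :=
  ∀ v, ∑ j with Γ.vertex j = v, t j = 0

/-- Turns the values `f'(xⱼ)` into the derivatives `∂f(xⱼ)` in the direction from the vertex into
the edge. -/
def inward (t : E × Bool → ℂ) : E × Bool → ℂ := fun j => if j.2 then - t j else t j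

variable {Γ}

lemma HasBoundaryValues.zero : Γ.HasBoundaryValues 0 0 := by
  intro j
  refine Tendsto.congr' ?_ tendsto_const_nhds
  have h : ((0 : Lp ℂ 2 (Γ.edgeMeasure j.1)) : ℝ → ℂ) =ᵐ[Γ.edgeMeasure j.1] 0 :=
    Lp.coeFn_zero ℂ 2 _
  exact (h.filter_mono inf_le_right).symm

lemma HasBoundaryValues.add {f g : Γ.L2} {s t : E × Bool → ℂ}
    (hf : Γ.HasBoundaryValues f s) (hg : Γ.HasBoundaryValues g t) :
    Γ.HasBoundaryValues (f + g) (s + t) := by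
  intro j
  refine Tendsto.congr' ?_ ((hf j).add (hg j))
  exact ((Lp.coeFn_add (f j.1) (g j.1)).filter_mono inf_le_right).symm

lemma HasBoundaryValues.smul {f : Γ.L2} {s : E × Bool → ℂ} (c : ℂ)
    (hf : Γ.HasBoundaryValues f s) : Γ.HasBoundaryValues (c • f) (c • s) := by
  intro j
  refine Tendsto.congr' ?_ ((hf j).const_smul c)
  exact ((Lp.coeFn_smul c (f j.1)).filter_mono inf_le_right).symm

lemma IsContinuousAtVertices.add {s t : E × Bool → ℂ} (hs : Γ.IsContinuousAtVertices s)
    (ht : Γ.IsContinuousAtVertices t) : Γ.IsContinuousAtVertices (s + t) := fun i j h => by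
  simp [hs i j h, ht i j h]

lemma IsContinuousAtVertices.smul {s : E × Bool → ℂ} (c : ℂ)
    (hs : Γ.IsContinuousAtVertices s) : Γ.IsContinuousAtVertices (c • s) := fun i j h => by
  simp [hs i j h]

lemma IsContinuousAtVertices.zero : Γ.IsContinuousAtVertices 0 := fun _ _ _ => rfl

lemma IsBalancedAtVertices.add [Fintype E] {s t : E × Bool → ℂ}
    (hs : Γ.IsBalancedAtVertices s) (ht : Γ.IsBalancedAtVertices t) :
    Γ.IsBalancedAtVertices (s + t) := fun v => by
  simp [Finset.sum_add_distrib, hs v, ht v]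

lemma IsBalancedAtVertices.smul [Fintype E] {s : E × Bool → ℂ} (c : ℂ)
    (hs : Γ.IsBalancedAtVertices s) : Γ.IsBalancedAtVertices (c • s) := fun v => by
  simp [← Finset.mul_sum, hs v]

lemma IsBalancedAtVertices.zero [Fintype E] : Γ.IsBalancedAtVertices 0 := fun v => by simp

lemma inward_add (s t : E × Bool → ℂ) : inward (s + t) = inward s + inward t := by
  funext j; by_cases h : j.2 <;> simp [inward, h, add_comm]

lemma inward_smul (c : ℂ) (s : E × Bool → ℂ) : inward (c • s) = c • inward s := by
  funext j; by_cases h : j.2 <;> simp [inward, h]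

lemma inward_zero : inward (0 : E × Bool → ℂ) = 0 := by
  funext j; simp [inward]

variable (Γ)

/-- The weak derivative as an unbounded operator in `L₂(Γ)` with domain `W₂¹(Γ \ V)`. -/
def ddx : Γ.L2 →ₗ.[ℂ] Γ.L2 := ⟨Γ.W1, Γ.weakDeriv⟩

/-- The second weak derivative `f ↦ (f')'`. Its domain is the Sobolev space `W₂²(Γ \ V)` of all
`f ∈ W₂¹(Γ \ V)` with `f' ∈ W₂¹(Γ \ V)`. -/
def ddx₂ : Γ.L2 →ₗ.[ℂ] Γ.L2 := UnboundedOperator.prod Γ.ddx Γ.ddx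

/-- The Sobolev space `W₂²(Γ \ V)`. -/
def W2 : Submodule ℂ Γ.L2 := Γ.ddx₂.domain

/-- Functions whose limiting values `f(xⱼ)` exist and satisfy the continuity condition. -/
def continuousValues : Submodule ℂ Γ.L2 where
  carrier := {f | ∃ t, Γ.HasBoundaryValues f t ∧ Γ.IsContinuousAtVertices t}
  zero_mem' := ⟨0, .zero, .zero⟩
  add_mem' := fun ⟨_, hf, hs⟩ ⟨_, hg, ht⟩ => ⟨_, hf.add hg, hs.add ht⟩
  smul_mem' := fun c _ ⟨_, hf, hs⟩ => ⟨_, hf.smul c, hs.smul c⟩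

/-- Functions whose limiting values `f(xⱼ)` exist and satisfy the balance condition. -/
def balancedValues [Fintype E] : Submodule ℂ Γ.L2 where
  carrier := {f | ∃ t, Γ.HasBoundaryValues f t ∧ Γ.IsBalancedAtVertices t}
  zero_mem' := ⟨0, .zero, .zero⟩
  add_mem' := fun ⟨_, hf, hs⟩ ⟨_, hg, ht⟩ => ⟨_, hf.add hg, hs.add ht⟩
  smul_mem' := fun c _ ⟨_, hf, hs⟩ => ⟨_, hf.smul c, hs.smul c⟩

/-- Functions `f'` for which the values `∂f(xⱼ)` exist and satisfy the continuity condition. -/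
def continuousInward : Submodule ℂ Γ.L2 where
  carrier := {f' | ∃ t, Γ.HasBoundaryValues f' t ∧ Γ.IsContinuousAtVertices (inward t)}
  zero_mem' := ⟨0, .zero, by rw [inward_zero]; exact .zero⟩
  add_mem' := fun ⟨_, hf, hs⟩ ⟨_, hg, ht⟩ =>
    ⟨_, hf.add hg, by rw [inward_add]; exact hs.add ht⟩
  smul_mem' := fun c _ ⟨_, hf, hs⟩ => ⟨_, hf.smul c, by rw [inward_smul]; exact hs.smul c⟩

/-- Functions `f'` for which the values `∂f(xⱼ)` exist and satisfy the balance condition. -/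
def balancedInward [Fintype E] : Submodule ℂ Γ.L2 where
  carrier := {f' | ∃ t, Γ.HasBoundaryValues f' t ∧ Γ.IsBalancedAtVertices (inward t)}
  zero_mem' := ⟨0, .zero, by rw [inward_zero]; exact .zero⟩
  add_mem' := fun ⟨_, hf, hs⟩ ⟨_, hg, ht⟩ =>
    ⟨_, hf.add hg, by rw [inward_add]; exact hs.add ht⟩
  smul_mem' := fun c _ ⟨_, hf, hs⟩ => ⟨_, hf.smul c, by rw [inward_smul]; exact hs.smul c⟩

/-- The operator `f ↦ -f''` with domain the functions `f` in `W₂²(Γ \ V)` such that `f` lies in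
`P` and `f'` lies in `Q`. -/
def laplacian (P Q : Submodule ℂ Γ.L2) : Γ.L2 →ₗ.[ℂ] Γ.L2 where
  domain := Γ.W2 ⊓ (P ⊓ (Q.comap Γ.weakDeriv).map Γ.W1.subtype)
  toFun := - (Γ.ddx₂.toFun ∘ₗ Submodule.inclusion inf_le_left)

/-- The standard (Kirchhoff) Laplacian: `f ↦ -f''` on the functions in `W₂²(Γ \ V)` with
continuous values and balanced inward derivatives at each vertex. -/
def standardLaplacian [Fintype E] : Γ.L2 →ₗ.[ℂ] Γ.L2 :=
  Γ.laplacian Γ.continuousValues Γ.balancedInward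

/-- The anti-standard (anti-Kirchhoff) Laplacian: `f ↦ -f''` on the functions in `W₂²(Γ \ V)`
with balanced values and continuous inward derivatives at each vertex. -/
def antiStandardLaplacian [Fintype E] : Γ.L2 →ₗ.[ℂ] Γ.L2 :=
  Γ.laplacian Γ.balancedValues Γ.continuousInward

/-- The momentum operator `D f = (1/i) f'` on the functions in `W₂¹(Γ \ V)` that satisfy the
continuity condition at each vertex. -/
def momentum : Γ.L2 →ₗ.[ℂ] Γ.L2 where
  domain := Γ.W1 ⊓ Γ.continuousValues
  toFun := (1 / Complex.I) • (Γ.weakDeriv ∘ₗ Submodule.inclusion inf_le_left)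

end MetricGraph

end

/-!
By the du Bois-Reymond lemma, a function in `W₂¹(Γ \ V)` has on every edge an absolutely continuous
representative, so integration by parts gives `⟪f', g⟫ + ⟪f, g'⟫ = -∑ⱼ ± conj f(xⱼ) g(xⱼ)`, with
the sign `+` at left and `-` at right endpoints, that is, the sign of the inward direction. Testing
against smooth functions supported inside a single edge, and against edgewise affine functions that
are continuous at the vertices, shows that `D*` is `f ↦ (1/i) f'` on the functions whose inward
signed boundary values are balanced at every vertex. Hence `D* D` carries precisely the standard
vertex conditions. In a bipartite oriented graph the inward sign is constant on each vertex, so it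
disappears from both kinds of vertex conditions and `D D*` carries the anti-standard ones. Finally
`D` intertwines `D* D` and `D D*`, and for `μ ≠ 0` it is an isomorphism between their eigenspaces,
with inverse `μ⁻¹ D*`.
-/

open scoped Distributions

section IntervalAnalysis

variable {X : Type*} [NormedAddCommGroup X] [NormedSpace ℝ X] {a b : ℝ}

/-- `F` is an absolutely continuous primitive of the integrable function `f` on the interval with
endpoints `a` and `b`. -/
structure IsACPrimitive (F f : ℝ → X) (a b : ℝ) : Prop where
  intervalIntegrable : IntervalIntegrable f volume a b
  absolutelyContinuous : AbsolutelyContinuousOnInterval F a b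
  ae_hasDerivAt : ∀ᵐ x, x ∈ Set.uIcc a b → HasDerivAt F (f x) x

theorem absolutelyContinuousOnInterval_integral {f : ℝ → X}
    (hf : IntervalIntegrable f volume a b) :
    AbsolutelyContinuousOnInterval (fun x => ∫ t in a..x, f t) a b := by
  refine squeeze_zero' (Eventually.of_forall fun I => Finset.sum_nonneg fun _ _ => dist_nonneg)
    ?_ (hf.norm.absolutelyContinuousOnInterval_intervalIntegral Set.left_mem_uIcc)
  filter_upwards [mem_inf_of_right (mem_principal_self _)] with I hI
  refine Finset.sum_le_sum fun i hi => ?_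
  obtain ⟨h₁, h₂⟩ := hI.1 i hi
  replace h₁ := Set.uIcc_subset_uIcc_left h₁
  replace h₂ := Set.uIcc_subset_uIcc_left h₂
  rw [dist_eq_norm, dist_eq_norm, Real.norm_eq_abs,
    intervalIntegral.integral_interval_sub_left (hf.mono_set h₁) (hf.mono_set h₂),
    intervalIntegral.integral_interval_sub_left (hf.norm.mono_set h₁) (hf.norm.mono_set h₂)]
  exact intervalIntegral.norm_integral_le_abs_integral_norm

theorem isACPrimitive_integral [CompleteSpace X] {f : ℝ → X}
    (hf : IntervalIntegrable f volume a b) : IsACPrimitive (fun x => ∫ t in a..x, f t) f a b where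
  intervalIntegrable := hf
  absolutelyContinuous := absolutelyContinuousOnInterval_integral hf
  ae_hasDerivAt := by
    filter_upwards [hf.ae_hasDerivAt_integral] with x hx hxab using hx hxab a Set.left_mem_uIcc

theorem isACPrimitive_of_hasDerivAt {F f : ℝ → X} (hF : ∀ x, HasDerivAt F (f x) x)
    (hf : Continuous f) (a b : ℝ) : IsACPrimitive F f a b where
  intervalIntegrable := hf.intervalIntegrable a b
  absolutelyContinuous := by
    have hderiv : deriv F = f := funext fun x => (hF x).deriv
    exact ContDiffOn.absolutelyContinuousOnInterval
      (contDiff_one_iff_deriv.2 ⟨fun x => (hF x).differentiableAt, hderiv ▸ hf⟩).contDiffOn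
  ae_hasDerivAt := Eventually.of_forall fun x _ => hF x

namespace IsACPrimitive

variable {F f : ℝ → X}

protected theorem continuousOn (hF : IsACPrimitive F f a b) : ContinuousOn F (Set.uIcc a b) :=
  hF.absolutelyContinuous.continuousOn

theorem add_const (hF : IsACPrimitive F f a b) (c : X) :
    IsACPrimitive (fun x => F x + c) f a b where
  intervalIntegrable := hF.intervalIntegrable
  absolutelyContinuous :=
    hF.absolutelyContinuous.fun_add (ContDiffOn.absolutelyContinuousOnInterval contDiffOn_const)
  ae_hasDerivAt := by
    filter_upwards [hF.ae_hasDerivAt] with x hx hxab using (hx hxab).add_const c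

theorem congr_ae {g : ℝ → X} (hF : IsACPrimitive F f a b)
    (h : f =ᵐ[volume.restrict (Set.uIcc a b)] g) : IsACPrimitive F g a b where
  intervalIntegrable := hF.intervalIntegrable.congr_ae
    (ae_restrict_of_ae_restrict_of_subset Set.uIoc_subset_uIcc h)
  absolutelyContinuous := hF.absolutelyContinuous
  ae_hasDerivAt := by
    filter_upwards [hF.ae_hasDerivAt, (ae_restrict_iff' measurableSet_uIcc).1 h]
      with x hx hfg hxab using hfg hxab ▸ hx hxab

theorem integral_eq_sub [CompleteSpace X] (hF : IsACPrimitive F f a b) :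
    ∫ x in a..b, f x = F b - F a := by
  have hG := isACPrimitive_integral hF.intervalIntegrable
  obtain ⟨C, hC⟩ :=
    (hF.absolutelyContinuous.fun_sub hG.absolutelyContinuous).const_of_ae_hasDerivAt_zero (by
      filter_upwards [hF.ae_hasDerivAt, hG.ae_hasDerivAt] with x hFx hGx hxab
      simpa using (hFx hxab).fun_sub (hGx hxab))
  have h := (hC a Set.left_mem_uIcc).trans (hC b Set.right_mem_uIcc).symm
  rw [intervalIntegral.integral_same, sub_zero] at h
  rw [h, sub_sub_cancel]

theorem smul {𝕜 : Type*} [RCLike 𝕜] [NormedSpace 𝕜 X] [IsScalarTower ℝ 𝕜 X] {u u' : ℝ → 𝕜}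
    (hu : IsACPrimitive u u' a b) (hF : IsACPrimitive F f a b) :
    IsACPrimitive (fun x => u x • F x) (fun x => u x • f x + u' x • F x) a b where
  intervalIntegrable := (hF.intervalIntegrable.continuousOn_smul hu.continuousOn).add
    (hu.intervalIntegrable.smul_continuousOn hF.continuousOn)
  absolutelyContinuous := hu.absolutelyContinuous.fun_smul hF.absolutelyContinuous
  ae_hasDerivAt := by
    filter_upwards [hu.ae_hasDerivAt, hF.ae_hasDerivAt] with x hux hFx hxab
    exact (hux hxab).fun_smul (hFx hxab)

theorem star [StarAddMonoid X] [NormedStarGroup X] [StarModule ℝ X]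
    (hF : IsACPrimitive F f a b) :
    IsACPrimitive (fun x => star (F x)) (fun x => star (f x)) a b where
  intervalIntegrable :=
    ⟨(starL' ℝ : X ≃L[ℝ] X).toContinuousLinearMap.integrable_comp hF.intervalIntegrable.1,
      (starL' ℝ : X ≃L[ℝ] X).toContinuousLinearMap.integrable_comp hF.intervalIntegrable.2⟩
  absolutelyContinuous := by
    simpa only [AbsolutelyContinuousOnInterval, star_isometry.dist_eq] using hF.absolutelyContinuous
  ae_hasDerivAt := by
    filter_upwards [hF.ae_hasDerivAt] with x hx hxab using (hx hxab).star

end IsACPrimitive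

/-- The open interval `(a, b)` as an open set, the domain of the test functions
`𝓓(openInterval a b, X)`. -/
abbrev openInterval (a b : ℝ) : TopologicalSpace.Opens ℝ := ⟨Set.Ioo a b, isOpen_Ioo⟩

theorem support_testFunction_subset (φ : 𝓓(openInterval a b, X)) :
    Function.support φ ⊆ Set.Ioo a b :=
  (subset_tsupport φ).trans φ.tsupport_subset

theorem continuous_deriv_testFunction (φ : 𝓓(openInterval a b, X)) : Continuous (deriv φ) :=
  φ.contDiff.continuous_deriv (by simp)

theorem hasDerivAt_testFunction (φ : 𝓓(openInterval a b, X)) (x : ℝ) :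
    HasDerivAt φ (deriv φ x) x :=
  (φ.contDiff.differentiable (by simp) x).hasDerivAt

theorem testFunction_apply_eq_zero (φ : 𝓓(openInterval a b, X)) {x : ℝ} (hx : x ∉ Set.Ioo a b) :
    φ x = 0 :=
  Function.notMem_support.1 fun h => hx (support_testFunction_subset φ h)

theorem exists_Icc_subset_Ioo_of_isCompact {K : Set ℝ} (hK : IsCompact K)
    (hKab : K ⊆ Set.Ioo a b) : ∃ c d, K ⊆ Set.Icc c d ∧ Set.Icc c d ⊆ Set.Ioo a b := by
  rcases K.eq_empty_or_nonempty with rfl | hne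
  · exact ⟨1, 0, by simp⟩
  · obtain ⟨c, hcK, hc⟩ := hK.exists_isLeast hne
    obtain ⟨d, hdK, hd⟩ := hK.exists_isGreatest hne
    exact ⟨c, d, fun x hx => ⟨hc hx, hd hx⟩, Set.Icc_subset_Ioo (hKab hcK).1 (hKab hdK).2⟩

theorem support_integral_Iic_subset_Icc {φ : ℝ → X} {c d : ℝ}
    (hφ : Function.support φ ⊆ Set.Icc c d) (h0 : ∫ x, φ x = 0) :
    Function.support (fun x => ∫ t in Set.Iic x, φ t) ⊆ Set.Icc c d := by
  have hφ0 : ∀ t ∉ Set.Icc c d, φ t = 0 := fun t ht => Function.notMem_support.1 fun h => ht (hφ h)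
  intro x hx
  by_contra hxcd
  rcases lt_or_ge x c with hxc | hcx
  · refine hx (setIntegral_eq_zero_of_forall_eq_zero fun t ht => hφ0 t fun htcd => ?_)
    exact (htcd.1.trans ht).not_gt hxc
  · refine hx ((setIntegral_eq_integral_of_forall_compl_eq_zero fun t ht => hφ0 t ?_).trans h0)
    exact fun htcd => ht (htcd.2.trans (le_of_not_ge fun hxd => hxcd ⟨hcx, hxd⟩))

theorem hasDerivAt_integral_Iic [CompleteSpace X] {f : ℝ → X} (hf : Continuous f)
    (hfi : Integrable f) (x : ℝ) : HasDerivAt (fun x => ∫ t in Set.Iic x, f t) (f x) x := by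
  have h (y : ℝ) : ∫ t in Set.Iic y, f t = (∫ t in (0 : ℝ)..y, f t) + ∫ t in Set.Iic 0, f t := by
    rw [← intervalIntegral.integral_Iic_sub_Iic hfi.integrableOn hfi.integrableOn, sub_add_cancel]
  rw [funext h]
  exact (hf.integral_hasStrictDerivAt 0 x).hasDerivAt.add_const _

theorem exists_testFunction_deriv_eq [CompleteSpace X] (φ : 𝓓(openInterval a b, X))
    (h0 : ∫ x, φ x = 0) : ∃ ψ : 𝓓(openInterval a b, X), deriv ψ = φ := by
  obtain ⟨c, d, hcd, hcdab⟩ :=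
    exists_Icc_subset_Ioo_of_isCompact φ.hasCompactSupport.isCompact φ.tsupport_subset
  have hderiv := hasDerivAt_integral_Iic φ.continuous
    (φ.continuous.integrable_of_hasCompactSupport φ.hasCompactSupport)
  have hderiv_eq : deriv (fun x => ∫ t in Set.Iic x, φ t) = φ := funext fun x => (hderiv x).deriv
  have hsupp := support_integral_Iic_subset_Icc ((subset_tsupport φ).trans hcd) h0
  exact ⟨⟨_, contDiff_infty_iff_deriv.2
      ⟨fun x => (hderiv x).differentiableAt, hderiv_eq.symm ▸ φ.contDiff⟩,
    .of_support_subset_isCompact isCompact_Icc hsupp,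
    (closure_minimal hsupp isClosed_Icc).trans hcdab⟩, hderiv_eq⟩

theorem exists_testFunction_integral_eq_one (hab : a < b) :
    ∃ η : 𝓓(openInterval a b, ℝ), ∫ x, η x = 1 := by
  let B : ContDiffBump ((a + b) / 2) := ⟨(b - a) / 8, (b - a) / 4, by linarith, by linarith⟩
  refine ⟨⟨B.normed volume, B.contDiff_normed, B.hasCompactSupport_normed, ?_⟩, B.integral_normed⟩
  rw [B.tsupport_normed_eq, Real.closedBall_eq_Icc]
  refine Set.Icc_subset_Ioo ?_ ?_
  · change a < (a + b) / 2 - (b - a) / 4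
    linarith
  · change (a + b) / 2 + (b - a) / 4 < b
    linarith

theorem integral_testFunction_smul_eq (φ : 𝓓(openInterval a b, ℝ)) (h : ℝ → X) :
    ∫ x in a..b, φ x • h x = ∫ x, φ x • h x :=
  intervalIntegral.integral_eq_integral_of_support_subset <|
    (Function.support_smul_subset_left _ _).trans <|
      (support_testFunction_subset φ).trans Set.Ioo_subset_Ioc_self

theorem ae_eq_zero_of_forall_integral_testFunction_smul_eq_zero [CompleteSpace X] {h : ℝ → X}
    (hab : a ≤ b) (hh : IntervalIntegrable h volume a b)
    (h0 : ∀ φ : 𝓓(openInterval a b, ℝ), ∫ x in a..b, φ x • h x = 0) :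
    h =ᵐ[volume.restrict (Set.Icc a b)] 0 := by
  rw [← restrict_Ioo_eq_restrict_Icc, EventuallyEq, ae_restrict_iff' measurableSet_Ioo]
  refine isOpen_Ioo.ae_eq_zero_of_integral_contDiff_smul_eq_zero
    ((intervalIntegrable_iff_integrableOn_Ioo_of_le hab).1 hh).locallyIntegrableOn
    fun φ hφ hc hs => ?_
  have := h0 ⟨φ, hφ, hc, hs⟩
  rwa [integral_testFunction_smul_eq] at this

theorem IsACPrimitive.integral_deriv_smul_eq_neg [CompleteSpace X] {F f : ℝ → X}
    (hF : IsACPrimitive F f a b) (φ : 𝓓(openInterval a b, ℝ)) :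
    ∫ x in a..b, deriv φ x • F x = -∫ x in a..b, φ x • f x := by
  have hφ := isACPrimitive_of_hasDerivAt (hasDerivAt_testFunction φ)
    (continuous_deriv_testFunction φ) a b
  have h := (hφ.smul hF).integral_eq_sub
  rw [intervalIntegral.integral_add (hF.intervalIntegrable.continuousOn_smul hφ.continuousOn)
    (hφ.intervalIntegrable.smul_continuousOn hF.continuousOn),
    testFunction_apply_eq_zero φ (x := a) (by simp),
    testFunction_apply_eq_zero φ (x := b) (by simp), zero_smul, zero_smul, sub_zero] at h
  exact eq_neg_of_add_eq_zero_right h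

theorem exists_ae_eq_const_of_forall_integral_deriv_smul_eq_zero [CompleteSpace X] (hab : a < b)
    {h : ℝ → X} (hh : IntervalIntegrable h volume a b)
    (h0 : ∀ φ : 𝓓(openInterval a b, ℝ), ∫ x in a..b, deriv φ x • h x = 0) :
    ∃ c, h =ᵐ[volume.restrict (Set.Icc a b)] fun _ => c := by
  obtain ⟨η, hη⟩ := exists_testFunction_integral_eq_one hab
  have hint (φ : 𝓓(openInterval a b, ℝ)) : Integrable φ :=
    φ.continuous.integrable_of_hasCompactSupport φ.hasCompactSupport
  have hmul (φ : 𝓓(openInterval a b, ℝ)) {g : ℝ → X} (hg : IntervalIntegrable g volume a b) :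
      IntervalIntegrable (fun x => φ x • g x) volume a b :=
    hg.continuousOn_smul φ.continuous.continuousOn
  let c := ∫ x in a..b, η x • h x
  have hconst : IntervalIntegrable (fun _ => c) volume a b := intervalIntegrable_const
  refine ⟨c, (sub_ae_eq_zero h fun _ => c).1 ?_⟩
  refine ae_eq_zero_of_forall_integral_testFunction_smul_eq_zero hab.le (hh.sub hconst) fun φ => ?_
  -- `φ - (∫ φ) η` has integral zero, so it is the derivative of a test function.
  obtain ⟨ψ, hψ⟩ := exists_testFunction_deriv_eq (φ - (∫ x, φ x) • η) (by
    simp [integral_sub (hint φ) ((hint η).const_mul _), integral_const_mul, hη])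
  have hφc : ∫ x in a..b, φ x • c = (∫ x, φ x) • c := by
    rw [integral_testFunction_smul_eq, integral_smul_const]
  calc ∫ x in a..b, φ x • (h x - c)
      = (∫ x in a..b, φ x • h x) - (∫ x, φ x) • c := by
        simp only [smul_sub]
        rw [intervalIntegral.integral_sub (hmul φ hh) (hmul φ hconst), hφc]
    _ = ∫ x in a..b, deriv ψ x • h x := by
        simp only [hψ, FunLike.coe_sub, FunLike.coe_smul, Pi.sub_apply, Pi.smul_apply,
          smul_eq_mul, sub_smul, mul_smul]
        rw [intervalIntegral.integral_sub (hmul φ hh)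
          ((hmul η hh).continuousOn_smul continuousOn_const), intervalIntegral.integral_smul]
    _ = 0 := h0 ψ

theorem exists_isACPrimitive_ae_eq [CompleteSpace X] (hab : a < b) {h g : ℝ → X}
    (hh : IntervalIntegrable h volume a b) (hg : IntervalIntegrable g volume a b)
    (hhg : ∀ φ : 𝓓(openInterval a b, ℝ),
      ∫ x in a..b, deriv φ x • h x = -∫ x in a..b, φ x • g x) :
    ∃ F, h =ᵐ[volume.restrict (Set.Icc a b)] F ∧ IsACPrimitive F g a b := by
  have hG := isACPrimitive_integral hg
  have hGi : IntervalIntegrable (fun x => ∫ t in a..x, g t) volume a b :=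
    hG.continuousOn.intervalIntegrable
  obtain ⟨c, hc⟩ := exists_ae_eq_const_of_forall_integral_deriv_smul_eq_zero hab (hh.sub hGi)
    fun φ => by
      have hφ' := (continuous_deriv_testFunction φ).continuousOn (s := Set.uIcc a b)
      simp only [smul_sub]
      rw [intervalIntegral.integral_sub (hh.continuousOn_smul hφ')
        (hGi.continuousOn_smul hφ'), hhg φ, hG.integral_deriv_smul_eq_neg φ, sub_self]
  refine ⟨_, ?_, hG.add_const c⟩
  filter_upwards [hc] with x hx
  rw [← hx, add_sub_cancel]

end IntervalAnalysis

namespace UnboundedOperator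

variable {H : Type*} [AddCommGroup H] [Module ℂ H]

theorem mem_graph_prod_iff {S T : H →ₗ.[ℂ] H} {x y : H} :
    (x, y) ∈ (prod S T).graph ↔ ∃ z, (x, z) ∈ T.graph ∧ (z, y) ∈ S.graph := by
  simp only [LinearPMap.mem_graph_iff]
  constructor
  · rintro ⟨⟨_, w, hw, rfl⟩, rfl, rfl⟩
    exact ⟨T w, ⟨w, rfl, rfl⟩, ⟨T w, hw⟩, rfl, rfl⟩
  · rintro ⟨_, ⟨w, rfl, rfl⟩, z, hz, rfl⟩
    refine ⟨⟨w, w, ?_, rfl⟩, rfl, ?_⟩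
    · change T w ∈ S.domain
      rw [← hz]; exact z.2
    · change S _ = S _
      congr 1
      exact Subtype.ext hz.symm

theorem mem_eigenspace_iff {T : H →ₗ.[ℂ] H} {μ : ℂ} {x : H} :
    x ∈ eigenspace T μ ↔ (x, μ • x) ∈ T.graph := by
  simp only [eigenspace, Submodule.mem_map, LinearMap.mem_ker, LinearMap.sub_apply,
    LinearMap.smul_apply, LinearPMap.mem_graph_iff, sub_eq_zero]
  constructor
  · rintro ⟨y, hy, rfl⟩
    exact ⟨y, rfl, hy⟩
  · rintro ⟨y, rfl, hy⟩
    exact ⟨y, hy, rfl⟩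

theorem isEigenvalue_iff {T : H →ₗ.[ℂ] H} {μ : ℂ} :
    IsEigenvalue T μ ↔ eigenspace T μ ≠ ⊥ := by
  rw [Submodule.ne_bot_iff]
  constructor
  · rintro ⟨x, hx, h⟩
    exact ⟨x, mem_eigenspace_iff.2 ((LinearPMap.mem_graph_iff _).2 ⟨x, rfl, h⟩), hx⟩
  · rintro ⟨x, hx, h⟩
    obtain ⟨y, rfl, hy⟩ := (LinearPMap.mem_graph_iff _).1 (mem_eigenspace_iff.1 hx)
    exact ⟨y, h, hy⟩

theorem eigenspace_prod_le_domain {S T : H →ₗ.[ℂ] H} {μ : ℂ} :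
    eigenspace (prod S T) μ ≤ T.domain := fun _ hx => by
  obtain ⟨z, hz, -⟩ := mem_graph_prod_iff.1 (mem_eigenspace_iff.1 hx)
  exact LinearPMap.mem_domain_of_mem_graph hz

/-- The map from `ker (S T - μ)` to `ker (T S - μ)` given by `T`. -/
noncomputable def eigenspaceMap (S T : H →ₗ.[ℂ] H) (μ : ℂ) :
    eigenspace (prod S T) μ →ₗ[ℂ] eigenspace (prod T S) μ :=
  (T.toFun ∘ₗ Submodule.inclusion eigenspace_prod_le_domain).codRestrict _ fun x => by
    obtain ⟨z, hz, hz'⟩ := mem_graph_prod_iff.1 (mem_eigenspace_iff.1 x.2)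
    have hx : z = T ⟨x, eigenspace_prod_le_domain x.2⟩ :=
      LinearPMap.mem_graph_snd_inj T hz (T.mem_graph ⟨x, eigenspace_prod_le_domain x.2⟩) rfl
    subst hx
    refine mem_eigenspace_iff.2 (mem_graph_prod_iff.2 ⟨_, hz', ?_⟩)
    exact T.graph.smul_mem μ hz

theorem mem_graph_eigenspaceMap {S T : H →ₗ.[ℂ] H} {μ : ℂ} (x : eigenspace (prod S T) μ) :
    ((x : H), (eigenspaceMap S T μ x : H)) ∈ T.graph :=
  T.mem_graph ⟨x, eigenspace_prod_le_domain x.2⟩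

theorem eigenspaceMap_eigenspaceMap {S T : H →ₗ.[ℂ] H} {μ : ℂ}
    (x : eigenspace (prod S T) μ) : eigenspaceMap T S μ (eigenspaceMap S T μ x) = μ • x := by
  obtain ⟨z, hz, hz'⟩ := mem_graph_prod_iff.1 (mem_eigenspace_iff.1 x.2)
  have h : z = eigenspaceMap S T μ x :=
    LinearPMap.mem_graph_snd_inj T hz (mem_graph_eigenspaceMap x) rfl
  subst h
  exact Subtype.ext (LinearPMap.mem_graph_snd_inj S (mem_graph_eigenspaceMap _) hz' rfl)

/-- The isomorphism of `ker (S T - μ)` and `ker (T S - μ)` given by `T`, with inverse `μ⁻¹ S`. -/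
noncomputable def eigenspaceEquiv (S T : H →ₗ.[ℂ] H) {μ : ℂ} (hμ : μ ≠ 0) :
    eigenspace (prod S T) μ ≃ₗ[ℂ] eigenspace (prod T S) μ :=
  LinearEquiv.ofLinearMap (eigenspaceMap S T μ) (μ⁻¹ • eigenspaceMap T S μ)
    (LinearMap.ext fun x => by
      simp [eigenspaceMap_eigenspaceMap, smul_smul, hμ])
    (LinearMap.ext fun x => by
      simp [eigenspaceMap_eigenspaceMap, smul_smul, hμ])

theorem multiplicity_prod_comm (S T : H →ₗ.[ℂ] H) {μ : ℂ} (hμ : μ ≠ 0) :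
    multiplicity (prod S T) μ = multiplicity (prod T S) μ :=
  (eigenspaceEquiv S T hμ).rank_eq

theorem isEigenvalue_prod_comm (S T : H →ₗ.[ℂ] H) {μ : ℂ} (hμ : μ ≠ 0) :
    IsEigenvalue (prod S T) μ ↔ IsEigenvalue (prod T S) μ := by
  rw [isEigenvalue_iff, isEigenvalue_iff, ← Submodule.nontrivial_iff_ne_bot,
    ← Submodule.nontrivial_iff_ne_bot]
  exact (eigenspaceEquiv S T hμ).toEquiv.nontrivial_congr

end UnboundedOperator

namespace MetricGraph

variable {V E : Type*} {Γ : MetricGraph V E} {e : E}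

theorem uIcc_edge (e : E) :
    Set.uIcc (Γ.left e) (Γ.right e) = Set.Icc (Γ.left e) (Γ.right e) :=
  Set.uIcc_of_le (Γ.left_lt_right e).le

theorem intervalIntegrable_edge (u : Lp ℂ 2 (Γ.edgeMeasure e)) :
    IntervalIntegrable u volume (Γ.left e) (Γ.right e) :=
  (intervalIntegrable_iff_integrableOn_Icc_of_le (Γ.left_lt_right e).le).2
    ((Lp.memLp u).integrable (by norm_num))

theorem integral_edgeMeasure (h : ℝ → ℂ) :
    ∫ x, h x ∂(Γ.edgeMeasure e) = ∫ x in Γ.left e..Γ.right e, h x := by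
  rw [intervalIntegral.integral_of_le (Γ.left_lt_right e).le, ← integral_Icc_eq_integral_Ioc,
    edgeMeasure]

theorem hasWeakDeriv_iff_forall_testFunction {f f' : Γ.L2} : Γ.HasWeakDeriv f f' ↔
    ∀ e, ∀ φ : 𝓓(openInterval (Γ.left e) (Γ.right e), ℝ),
      ∫ x in Γ.left e..Γ.right e, deriv φ x • f e x =
        -∫ x in Γ.left e..Γ.right e, φ x • f' e x := by
  simp only [HasWeakDeriv, integral_edgeMeasure]
  exact ⟨fun h e φ => h e φ φ.contDiff φ.hasCompactSupport φ.tsupport_subset,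
    fun h e φ hφ hc hs => h e ⟨φ, hφ, hc, hs⟩⟩

theorem hasWeakDeriv_iff_exists_isACPrimitive {f f' : Γ.L2} : Γ.HasWeakDeriv f f' ↔
    ∀ e, ∃ F, f e =ᵐ[Γ.edgeMeasure e] F ∧ IsACPrimitive F (f' e) (Γ.left e) (Γ.right e) := by
  rw [hasWeakDeriv_iff_forall_testFunction]
  refine forall_congr' fun e => ⟨fun h => ?_, ?_⟩
  · exact exists_isACPrimitive_ae_eq (Γ.left_lt_right e) (intervalIntegrable_edge (f e))
      (intervalIntegrable_edge (f' e)) h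
  · rintro ⟨F, hfF, hF⟩ φ
    rw [← hF.integral_deriv_smul_eq_neg, ← integral_edgeMeasure, ← integral_edgeMeasure]
    exact integral_congr_ae (hfF.mono fun x hx => congrArg (deriv φ x • ·) hx)

theorem point_mem_Icc (j : E × Bool) :
    Γ.point j ∈ Set.Icc (Γ.left j.1) (Γ.right j.1) := by
  have := (Γ.left_lt_right j.1).le
  unfold point; split <;> simp [this]

theorem point_notMem_Ioo (j : E × Bool) :
    Γ.point j ∉ Set.Ioo (Γ.left j.1) (Γ.right j.1) := by
  unfold point; split <;> simp

instance nhds_point_inf_ae_neBot (j : E × Bool) :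
    (𝓝 (Γ.point j) ⊓ ae (Γ.edgeMeasure j.1)).NeBot := by
  refine (nhds_basis_opens _).inf_basis_neBot_iff (ae _).basis_sets |>.2 ?_
  rintro U ⟨hjU, hU⟩ t ht
  have hj : Γ.point j ∈ closure (Set.Ioo (Γ.left j.1) (Γ.right j.1)) := by
    rw [closure_Ioo (Γ.left_lt_right j.1).ne]
    exact point_mem_Icc j
  have hpos : Γ.edgeMeasure j.1 U ≠ 0 := by
    rw [edgeMeasure, ← restrict_Ioo_eq_restrict_Icc, Measure.restrict_apply hU.measurableSet]
    exact ((hU.inter isOpen_Ioo).measure_pos volume (mem_closure_iff.1 hj U hU hjU)).ne'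
  exact ((frequently_ae_mem_iff.2 hpos).and_eventually ht).exists

theorem HasBoundaryValues.unique {f : Γ.L2} {s t : E × Bool → ℂ}
    (hs : Γ.HasBoundaryValues f s) (ht : Γ.HasBoundaryValues f t) : s = t :=
  funext fun j => tendsto_nhds_unique (hs j) (ht j)

theorem hasBoundaryValues_of_ae_eq {f : Γ.L2} {F : E → ℝ → ℂ}
    (hF : ∀ e, ContinuousOn (F e) (Set.Icc (Γ.left e) (Γ.right e)))
    (hfF : ∀ e, f e =ᵐ[Γ.edgeMeasure e] F e) :
    Γ.HasBoundaryValues f fun j => F j.1 (Γ.point j) := fun j =>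
  Tendsto.congr' ((hfF j.1).filter_mono inf_le_right).symm <|
    (hF j.1 _ (point_mem_Icc j)).mono_left <|
      inf_le_inf_left _ (le_principal_iff.2 (self_mem_ae_restrict measurableSet_Icc))

theorem hasBoundaryValues_of_isACPrimitive {f f' : Γ.L2} {F : E → ℝ → ℂ}
    (hF : ∀ e, f e =ᵐ[Γ.edgeMeasure e] F e ∧
      IsACPrimitive (F e) (f' e) (Γ.left e) (Γ.right e)) :
    Γ.HasBoundaryValues f fun j => F j.1 (Γ.point j) :=
  hasBoundaryValues_of_ae_eq (fun e => uIcc_edge (Γ := Γ) e ▸ (hF e).2.continuousOn)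
    fun e => (hF e).1

theorem HasWeakDeriv.exists_hasBoundaryValues {f f' : Γ.L2} (h : Γ.HasWeakDeriv f f') :
    ∃ t, Γ.HasBoundaryValues f t := by
  choose F hF using hasWeakDeriv_iff_exists_isACPrimitive.1 h
  exact ⟨_, hasBoundaryValues_of_isACPrimitive hF⟩

theorem inner_add_inner_edge {u u' v v' : Lp ℂ 2 (Γ.edgeMeasure e)} {F G : ℝ → ℂ}
    (huF : u =ᵐ[Γ.edgeMeasure e] F) (hF : IsACPrimitive F u' (Γ.left e) (Γ.right e))
    (hvG : v =ᵐ[Γ.edgeMeasure e] G) (hG : IsACPrimitive G v' (Γ.left e) (Γ.right e)) :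
    ⟪u', v⟫_ℂ + ⟪u, v'⟫_ℂ = star (F (Γ.right e)) * G (Γ.right e) -
      star (F (Γ.left e)) * G (Γ.left e) := by
  have hFG := (hF.star.smul hG).integral_eq_sub
  simp only [smul_eq_mul] at hFG
  rw [← hFG, ← integral_edgeMeasure, L2.inner_def, L2.inner_def,
    ← integral_add (L2.integrable_inner u' v) (L2.integrable_inner u v')]
  refine integral_congr_ae ?_
  filter_upwards [huF, hvG] with x hu hv
  simp only [RCLike.inner_apply', hu, hv, starRingEnd_apply]
  ring

theorem inner_add_inner_eq_neg_sum [Fintype E] {f f' g g' : Γ.L2} {s t : E × Bool → ℂ}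
    (hf : Γ.HasWeakDeriv f f') (hg : Γ.HasWeakDeriv g g')
    (hs : Γ.HasBoundaryValues f s) (ht : Γ.HasBoundaryValues g t) :
    ⟪f', g⟫_ℂ + ⟪f, g'⟫_ℂ = -∑ j, star (s j) * inward t j := by
  choose F hF using hasWeakDeriv_iff_exists_isACPrimitive.1 hf
  choose G hG using hasWeakDeriv_iff_exists_isACPrimitive.1 hg
  rw [hs.unique (hasBoundaryValues_of_isACPrimitive hF),
    ht.unique (hasBoundaryValues_of_isACPrimitive hG), PiLp.inner_apply, PiLp.inner_apply,
    ← Finset.sum_add_distrib, Fintype.sum_prod_type, ← Finset.sum_neg_distrib]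
  refine Finset.sum_congr rfl fun e _ => ?_
  rw [inner_add_inner_edge (hF e).1 (hF e).2 (hG e).1 (hG e).2]
  simp [inward, point]
  ring

theorem memLp_edgeMeasure (u : C(ℝ, ℂ)) : MemLp u 2 (Γ.edgeMeasure e) := by
  obtain ⟨C, hC⟩ := isCompact_Icc.exists_bound_of_continuousOn
    (u.continuous.continuousOn (s := Set.Icc (Γ.left e) (Γ.right e)))
  exact .of_bound u.continuous.aestronglyMeasurable C
    (ae_restrict_of_forall_mem measurableSet_Icc hC)

/-- The element of `L₂(Γ)` that agrees on every edge `e` with the continuous function `u e`. -/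
noncomputable def ofContinuous (Γ : MetricGraph V E) (u : E → C(ℝ, ℂ)) : Γ.L2 :=
  WithLp.toLp 2 fun e => (memLp_edgeMeasure (u e)).toLp (u e)

theorem ofContinuous_ae_eq (u : E → C(ℝ, ℂ)) (e : E) :
    Γ.ofContinuous u e =ᵐ[Γ.edgeMeasure e] u e :=
  (memLp_edgeMeasure (u e)).coeFn_toLp

theorem hasBoundaryValues_ofContinuous (u : E → C(ℝ, ℂ)) :
    Γ.HasBoundaryValues (Γ.ofContinuous u) fun j => u j.1 (Γ.point j) :=
  hasBoundaryValues_of_ae_eq (fun e => (u e).continuous.continuousOn) (ofContinuous_ae_eq u)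

theorem hasWeakDeriv_ofContinuous {u u' : E → C(ℝ, ℂ)}
    (h : ∀ e x, HasDerivAt (u e) (u' e x) x) :
    Γ.HasWeakDeriv (Γ.ofContinuous u) (Γ.ofContinuous u') := by
  refine hasWeakDeriv_iff_exists_isACPrimitive.2 fun e => ⟨u e, ofContinuous_ae_eq u e, ?_⟩
  refine (isACPrimitive_of_hasDerivAt (h e) (u' e).continuous _ _).congr_ae ?_
  rw [uIcc_edge]
  exact (ofContinuous_ae_eq u' e).symm

theorem exists_hasWeakDeriv_hasBoundaryValues (Γ : MetricGraph V E) (s : E × Bool → ℂ) :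
    ∃ u u' : Γ.L2, Γ.HasWeakDeriv u u' ∧ Γ.HasBoundaryValues u s := by
  let k (e : E) : ℂ := (s (e, true) - s (e, false)) / (Γ.right e - Γ.left e)
  let u (e : E) : C(ℝ, ℂ) := ⟨fun x => s (e, false) + (x - Γ.left e) * k e, by fun_prop⟩
  have hu (e : E) (x : ℝ) : HasDerivAt (u e) (ContinuousMap.const ℝ (k e) x) x := by
    simpa [u] using (((hasDerivAt_id x).ofReal_comp.sub_const (Γ.left e : ℂ)).mul_const
      (k e)).const_add (s (e, false))
  have hus : (fun j => u j.1 (Γ.point j)) = s := by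
    funext ⟨e, d⟩
    have hne : (Γ.right e : ℂ) - Γ.left e ≠ 0 :=
      sub_ne_zero.2 (Complex.ofReal_injective.ne (Γ.left_lt_right e).ne')
    cases d
    · simp [u, point]
    · simp [u, point, k, mul_div_cancel₀ _ hne]
  exact ⟨_, _, hasWeakDeriv_ofContinuous hu, hus ▸ hasBoundaryValues_ofContinuous u⟩

open Classical in
/-- The element of `L₂(Γ)` that agrees with the real function `u` on the edge `e` and vanishes on
the other edges. -/
noncomputable def onEdge (Γ : MetricGraph V E) (e : E) (u : C(ℝ, ℝ)) : Γ.L2 :=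
  Γ.ofContinuous (Pi.single e (ContinuousMap.comp ⟨Complex.ofReal, Complex.continuous_ofReal⟩ u))

theorem hasWeakDeriv_onEdge {u u' : C(ℝ, ℝ)} (h : ∀ x, HasDerivAt u (u' x) x) (e : E) :
    Γ.HasWeakDeriv (Γ.onEdge e u) (Γ.onEdge e u') := by
  refine hasWeakDeriv_ofContinuous fun e' x => ?_
  rcases eq_or_ne e' e with rfl | he
  · simp only [Pi.single_eq_same]
    exact (h x).ofReal_comp
  · simp [he]

theorem inner_onEdge [Fintype E] (e : E) (u : C(ℝ, ℝ)) (w : Γ.L2) :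
    ⟪Γ.onEdge e u, w⟫_ℂ = ∫ x in Γ.left e..Γ.right e, u x • w e x := by
  rw [PiLp.inner_apply, Fintype.sum_eq_single e, L2.inner_def, ← integral_edgeMeasure]
  · refine integral_congr_ae ?_
    filter_upwards [ofContinuous_ae_eq (Γ := Γ) _ e] with x hx
    rw [onEdge, hx]
    simp [mul_comm]
  · intro e' he
    simp [onEdge, ofContinuous, he]

theorem onEdge_testFunction_mem_continuousValues
    (φ : 𝓓(openInterval (Γ.left e) (Γ.right e), ℝ)) : Γ.onEdge e φ ∈ Γ.continuousValues := by
  refine ⟨_, hasBoundaryValues_ofContinuous _, ?_⟩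
  convert IsContinuousAtVertices.zero (Γ := Γ) using 1
  funext j
  rcases eq_or_ne j.1 e with rfl | he
  · simp [testFunction_apply_eq_zero φ (point_notMem_Ioo j)]
  · simp [he]

theorem onEdge_testFunction_mem_domain_momentum
    (φ : 𝓓(openInterval (Γ.left e) (Γ.right e), ℝ)) : Γ.onEdge e φ ∈ Γ.momentum.domain :=
  ⟨⟨_, hasWeakDeriv_onEdge (u' := ⟨deriv φ, continuous_deriv_testFunction φ⟩)
    (hasDerivAt_testFunction φ) e⟩, onEdge_testFunction_mem_continuousValues φ⟩

theorem dense_domain_momentum [Finite E] (Γ : MetricGraph V E) :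
    Dense (Γ.momentum.domain : Set Γ.L2) := by
  have := Fintype.ofFinite E
  rw [Submodule.dense_iff_topologicalClosure_eq_top, Submodule.topologicalClosure_eq_top_iff,
    Submodule.eq_bot_iff]
  intro w hw
  ext1 e
  refine Lp.ext (EventuallyEq.trans ?_ (Lp.coeFn_zero ℂ 2 _).symm)
  refine ae_eq_zero_of_forall_integral_testFunction_smul_eq_zero (Γ.left_lt_right e).le
    (intervalIntegrable_edge (w e)) fun φ => ?_
  exact (inner_onEdge e φ w).symm.trans (hw _ (onEdge_testFunction_mem_domain_momentum φ))

section Adjoint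

variable [Fintype E]

theorem sum_star_mul_eq_zero {s t : E × Bool → ℂ} (hs : Γ.IsContinuousAtVertices s)
    (ht : Γ.IsBalancedAtVertices t) : ∑ j, star (s j) * t j = 0 := by
  classical
  rw [← Finset.sum_fiberwise_of_maps_to (g := Γ.vertex) (t := Finset.univ.image Γ.vertex)
    fun j _ => Finset.mem_image_of_mem _ (Finset.mem_univ j)]
  refine Finset.sum_eq_zero fun v hv => ?_
  obtain ⟨i, -, rfl⟩ := Finset.mem_image.1 hv
  rw [← mul_zero (star (s i)), ← ht (Γ.vertex i), Finset.mul_sum]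
  refine Finset.sum_congr (by congr) fun j hj => ?_
  rw [hs j i (Finset.mem_filter.1 hj).2]

theorem isBalancedAtVertices_of_forall_sum_star_mul_eq_zero {t : E × Bool → ℂ}
    (h : ∀ s, Γ.IsContinuousAtVertices s → ∑ j, star (s j) * t j = 0) :
    Γ.IsBalancedAtVertices t := fun v => by
  classical
  have hv := h (fun j => if Γ.vertex j = v then 1 else 0) fun i j hij => by simp only [hij]
  rw [Finset.sum_filter]
  refine (Finset.sum_congr rfl fun j _ => ?_).trans hv
  split_ifs <;> simp

theorem isBalancedAtVertices_iff_forall_sum_star_mul_eq_zero {t : E × Bool → ℂ} :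
    Γ.IsBalancedAtVertices t ↔
      ∀ s, Γ.IsContinuousAtVertices s → ∑ j, star (s j) * t j = 0 :=
  ⟨fun ht _ hs => sum_star_mul_eq_zero hs ht, isBalancedAtVertices_of_forall_sum_star_mul_eq_zero⟩

theorem inner_eq_neg_inner_iff {f f' u u' : Γ.L2} {s t : E × Bool → ℂ}
    (hu : Γ.HasWeakDeriv u u') (hf : Γ.HasWeakDeriv f f')
    (hs : Γ.HasBoundaryValues u s) (ht : Γ.HasBoundaryValues f t) :
    ⟪u', f⟫_ℂ = -⟪u, f'⟫_ℂ ↔ ∑ j, star (s j) * inward t j = 0 := by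
  rw [eq_neg_iff_add_eq_zero, inner_add_inner_eq_neg_sum hu hf hs ht, neg_eq_zero]

theorem hasWeakDeriv_of_forall_inner_eq_neg_inner {f f' : Γ.L2}
    (h : ∀ u u', Γ.HasWeakDeriv u u' → u ∈ Γ.continuousValues → ⟪u', f⟫_ℂ = -⟪u, f'⟫_ℂ) :
    Γ.HasWeakDeriv f f' := by
  refine hasWeakDeriv_iff_forall_testFunction.2 fun e φ => ?_
  let φ' : C(ℝ, ℝ) := ⟨deriv φ, continuous_deriv_testFunction φ⟩
  have := h _ _ (hasWeakDeriv_onEdge (u' := φ') (hasDerivAt_testFunction φ) e)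
    (onEdge_testFunction_mem_continuousValues φ)
  rwa [inner_onEdge, inner_onEdge] at this

theorem forall_inner_eq_neg_inner_iff {f f' : Γ.L2} :
    (∀ u u', Γ.HasWeakDeriv u u' → u ∈ Γ.continuousValues → ⟪u', f⟫_ℂ = -⟪u, f'⟫_ℂ) ↔
      Γ.HasWeakDeriv f f' ∧ f ∈ Γ.balancedInward := by
  constructor
  · intro h
    have hf := hasWeakDeriv_of_forall_inner_eq_neg_inner h
    obtain ⟨t, ht⟩ := hf.exists_hasBoundaryValues
    refine ⟨hf, t, ht, isBalancedAtVertices_iff_forall_sum_star_mul_eq_zero.2 fun s hs => ?_⟩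
    obtain ⟨u, u', hu, hus⟩ := Γ.exists_hasWeakDeriv_hasBoundaryValues s
    exact (inner_eq_neg_inner_iff hu hf hus ht).1 (h u u' hu ⟨s, hus, hs⟩)
  · rintro ⟨hf, t, ht, hb⟩ u u' hu ⟨s, hus, hs⟩
    exact (inner_eq_neg_inner_iff hu hf hus ht).2
      (isBalancedAtVertices_iff_forall_sum_star_mul_eq_zero.1 hb s hs)

end Adjoint

/-- The momentum operator `f ↦ (1/i) f'` on the functions in `W₂¹(Γ \ V)` that lie in `P`. -/
noncomputable def momentumOn (Γ : MetricGraph V E) (P : Submodule ℂ Γ.L2) :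
    Γ.L2 →ₗ.[ℂ] Γ.L2 where
  domain := Γ.W1 ⊓ P
  toFun := (1 / Complex.I) • (Γ.weakDeriv ∘ₗ Submodule.inclusion inf_le_left)

theorem momentum_eq_momentumOn (Γ : MetricGraph V E) :
    Γ.momentum = Γ.momentumOn Γ.continuousValues :=
  rfl

theorem weakDeriv_eq {f f' : Γ.L2} (h : Γ.HasWeakDeriv f f') : Γ.weakDeriv ⟨f, f', h⟩ = f' :=
  (Γ.hasWeakDeriv_weakDeriv ⟨f, f', h⟩).unique h

theorem hasWeakDeriv_smul_iff {f f' : Γ.L2} {c : ℂ} (hc : c ≠ 0) :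
    Γ.HasWeakDeriv (c • f) (c • f') ↔ Γ.HasWeakDeriv f f' :=
  ⟨fun h => by simpa only [inv_smul_smul₀ hc] using h.smul c⁻¹, .smul c⟩

theorem mem_graph_ddx_iff {f g : Γ.L2} : (f, g) ∈ Γ.ddx.graph ↔ Γ.HasWeakDeriv f g := by
  rw [LinearPMap.mem_graph_iff]
  constructor
  · rintro ⟨f, rfl, rfl⟩
    exact Γ.hasWeakDeriv_weakDeriv f
  · exact fun h => ⟨⟨f, g, h⟩, rfl, weakDeriv_eq h⟩

theorem mem_graph_ddx₂_iff {f g : Γ.L2} :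
    (f, g) ∈ Γ.ddx₂.graph ↔ ∃ f', Γ.HasWeakDeriv f f' ∧ Γ.HasWeakDeriv f' g := by
  simp only [ddx₂, UnboundedOperator.mem_graph_prod_iff, mem_graph_ddx_iff]

theorem mem_graph_momentumOn_iff {P : Submodule ℂ Γ.L2} {f g : Γ.L2} :
    (f, g) ∈ (Γ.momentumOn P).graph ↔ Γ.HasWeakDeriv f (Complex.I • g) ∧ f ∈ P := by
  rw [LinearPMap.mem_graph_iff]
  constructor
  · rintro ⟨f, rfl, rfl⟩
    refine ⟨?_, f.2.2⟩
    convert Γ.hasWeakDeriv_weakDeriv ⟨f, f.2.1⟩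
    exact (smul_smul ..).trans (by simp; rfl)
  · rintro ⟨h, hf⟩
    refine ⟨⟨f, ⟨_, h⟩, hf⟩, rfl, (congrArg ((1 / Complex.I) • ·) (weakDeriv_eq h)).trans ?_⟩
    simp [smul_smul]

theorem mem_graph_laplacian_iff {P Q : Submodule ℂ Γ.L2} {f g : Γ.L2} :
    (f, g) ∈ (Γ.laplacian P Q).graph ↔
      ∃ f', (Γ.HasWeakDeriv f f' ∧ f ∈ P) ∧ Γ.HasWeakDeriv f' (-g) ∧ f' ∈ Q := by
  rw [LinearPMap.mem_graph_iff]
  constructor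
  · rintro ⟨⟨f, h₂, hP, w, hQ, rfl⟩, rfl, rfl⟩
    obtain ⟨f', h, h'⟩ := mem_graph_ddx₂_iff.1 (Γ.ddx₂.mem_graph ⟨w, h₂⟩)
    refine ⟨f', ⟨h, hP⟩, (neg_neg (Γ.ddx₂ ⟨w, h₂⟩)).symm ▸ h', ?_⟩
    rw [← weakDeriv_eq h]
    exact hQ
  · rintro ⟨f', ⟨h, hP⟩, h', hQ⟩
    have hg := mem_graph_ddx₂_iff.2 ⟨f', h, h'⟩
    refine ⟨⟨f, LinearPMap.mem_domain_of_mem_graph hg, hP, ⟨f, f', h⟩, ?_, rfl⟩, rfl, ?_⟩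
    · change Γ.weakDeriv _ ∈ Q
      rwa [weakDeriv_eq h]
    · exact (congrArg Neg.neg (LinearPMap.mem_graph_snd_inj Γ.ddx₂
        (Γ.ddx₂.mem_graph _) hg rfl)).trans (neg_neg g)

theorem laplacian_eq_prod (P Q : Submodule ℂ Γ.L2) :
    Γ.laplacian P Q = UnboundedOperator.prod (Γ.momentumOn Q) (Γ.momentumOn P) := by
  refine LinearPMap.eq_of_eq_graph (Submodule.ext fun ⟨f, g⟩ => ?_)
  have hI : Function.Surjective fun z : Γ.L2 => Complex.I • z :=
    MulAction.surjective₀ Complex.I_ne_zero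
  have hg : -g = Complex.I • Complex.I • g := by rw [smul_smul, Complex.I_mul_I, neg_one_smul]
  rw [mem_graph_laplacian_iff, UnboundedOperator.mem_graph_prod_iff, hI.exists]
  simp only [mem_graph_momentumOn_iff, hg, hasWeakDeriv_smul_iff Complex.I_ne_zero,
    Submodule.smul_mem_iff _ Complex.I_ne_zero]

theorem momentum_adjoint [Fintype E] (Γ : MetricGraph V E) :
    Γ.momentum.adjoint = Γ.momentumOn Γ.balancedInward := by
  refine LinearPMap.eq_of_eq_graph (Submodule.ext fun ⟨f, g⟩ => ?_)
  have hI : Function.Surjective fun u' : Γ.L2 => Complex.I • u' :=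
    MulAction.surjective₀ Complex.I_ne_zero
  have hinner (u u' : Γ.L2) : ⟪u', f⟫_ℂ - ⟪u, g⟫_ℂ = 0 ↔
      ⟪Complex.I • u', f⟫_ℂ = -⟪u, Complex.I • g⟫_ℂ := by
    rw [inner_smul_left, inner_smul_right, Complex.conj_I, neg_mul, neg_inj,
      mul_right_inj' Complex.I_ne_zero, sub_eq_zero]
  rw [LinearPMap.adjoint_graph_eq_graph_adjoint Γ.dense_domain_momentum, Submodule.mem_adjoint_iff,
    mem_graph_momentumOn_iff, ← forall_inner_eq_neg_inner_iff]
  refine forall_congr' fun u => Iff.trans ?_ hI.forall.symm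
  simp only [momentum_eq_momentumOn, mem_graph_momentumOn_iff, and_imp, hinner]

theorem standardLaplacian_eq_prod [Fintype E] (Γ : MetricGraph V E) :
    Γ.standardLaplacian = UnboundedOperator.prod Γ.momentum.adjoint Γ.momentum := by
  rw [standardLaplacian, laplacian_eq_prod, momentum_adjoint, momentum_eq_momentumOn]

namespace IsBipartiteOriented

variable {V₁ V₂ : Set V}

theorem snd_eq (hΓ : Γ.IsBipartiteOriented V₁ V₂) {i j : E × Bool}
    (h : Γ.vertex i = Γ.vertex j) : i.2 = j.2 := by
  have hne (e e' : E) : Γ.vertex (e, false) ≠ Γ.vertex (e', true) :=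
    hΓ.disjoint.ne_of_mem (hΓ.left_mem e) (hΓ.right_mem e')
  match i, j with
  | (_, false), (_, false) | (_, true), (_, true) => rfl
  | (e, false), (e', true) => exact (hne e e' h).elim
  | (e, true), (e', false) => exact (hne e' e h.symm).elim

theorem isContinuousAtVertices_inward_iff (hΓ : Γ.IsBipartiteOriented V₁ V₂)
    {t : E × Bool → ℂ} : Γ.IsContinuousAtVertices (inward t) ↔ Γ.IsContinuousAtVertices t := by
  refine forall_congr' fun i => forall_congr' fun j => forall_congr' fun h => ?_
  simp only [inward, hΓ.snd_eq h]
  split_ifs <;> simp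

theorem continuousInward_eq (hΓ : Γ.IsBipartiteOriented V₁ V₂) :
    Γ.continuousInward = Γ.continuousValues :=
  Submodule.ext fun _ => exists_congr fun _ =>
    and_congr_right fun _ => hΓ.isContinuousAtVertices_inward_iff

theorem isBalancedAtVertices_inward_iff [Fintype E] (hΓ : Γ.IsBipartiteOriented V₁ V₂)
    {t : E × Bool → ℂ} : Γ.IsBalancedAtVertices (inward t) ↔ Γ.IsBalancedAtVertices t := by
  classical
  refine forall_congr' fun v => ?_
  obtain ⟨i, rfl⟩ := Γ.vertex_surjective v
  have hsum : ∑ j with Γ.vertex j = Γ.vertex i, inward t j =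
      (if i.2 then -1 else 1) * ∑ j with Γ.vertex j = Γ.vertex i, t j := by
    rw [Finset.mul_sum]
    refine Finset.sum_congr rfl fun j hj => ?_
    rw [inward, hΓ.snd_eq (Finset.mem_filter.1 hj).2]
    split_ifs <;> simp
  convert_to ∑ j with Γ.vertex j = Γ.vertex i, inward t j = 0 ↔
    ∑ j with Γ.vertex j = Γ.vertex i, t j = 0
  rw [hsum]
  split_ifs <;> simp

theorem balancedInward_eq [Fintype E] (hΓ : Γ.IsBipartiteOriented V₁ V₂) :
    Γ.balancedInward = Γ.balancedValues :=
  Submodule.ext fun _ => exists_congr fun _ =>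
    and_congr_right fun _ => hΓ.isBalancedAtVertices_inward_iff

theorem antiStandardLaplacian_eq_prod [Fintype E] (hΓ : Γ.IsBipartiteOriented V₁ V₂) :
    Γ.antiStandardLaplacian = UnboundedOperator.prod Γ.momentum Γ.momentum.adjoint := by
  rw [antiStandardLaplacian, laplacian_eq_prod, hΓ.continuousInward_eq, ← hΓ.balancedInward_eq,
    momentum_adjoint, momentum_eq_momentumOn]

end IsBipartiteOriented

end MetricGraph

theorem lemma3p1 {V E : Type*} [Fintype E] (Γ : MetricGraph V E) (V₁ V₂ : Set V)
    (hΓ : Γ.IsBipartiteOriented V₁ V₂) :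
    Dense (Γ.momentum.domain : Set Γ.L2) ∧
    Γ.standardLaplacian = UnboundedOperator.prod Γ.momentum.adjoint Γ.momentum ∧
    Γ.antiStandardLaplacian = UnboundedOperator.prod Γ.momentum Γ.momentum.adjoint ∧
    ∀ μ : ℝ, 0 < μ →
      (UnboundedOperator.IsEigenvalue Γ.standardLaplacian μ ↔
        UnboundedOperator.IsEigenvalue Γ.antiStandardLaplacian μ) ∧
      UnboundedOperator.multiplicity Γ.standardLaplacian μ =
        UnboundedOperator.multiplicity Γ.antiStandardLaplacian μ := by
  refine ⟨Γ.dense_domain_momentum, Γ.standardLaplacian_eq_prod,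
    hΓ.antiStandardLaplacian_eq_prod, fun μ hμ => ?_⟩
  have hμ' : (μ : ℂ) ≠ 0 := Complex.ofReal_ne_zero.2 hμ.ne'
  rw [Γ.standardLaplacian_eq_prod, hΓ.antiStandardLaplacian_eq_prod]
  exact ⟨UnboundedOperator.isEigenvalue_prod_comm _ _ hμ',
    UnboundedOperator.multiplicity_prod_comm _ _ hμ'⟩
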